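/- Let $\mathscr H$ be a complex Hilbert space, let $\mathbb B(\mathscr H)$ be the algebra of bounded linear operators on $\mathscr H$, and write $S\le T$ for self-adjoint $S,T\in\mathbb B(\mathscr H)$ if $\langle (T-S)x,x\rangle\ge 0$ for all $x\in\mathscr H$. Let $A,B\in\mathbb B(\mathscr H)$ be positive operators (that is, $A\ge 0$ and $B\ge 0$; they need not be invertible), and for a positive integer $n$ put $$\mathcal K_{n,A,B}=\{U\in\mathbb B(\mathscr H): U \text{ is unitary and } A^{n}\le U^*B^{n}U\}.$$ Suppose that for some positive integer $n_0$ the set $\mathcal K_{n_0,A,B}$ is nonempty and is either compact in the strong operator topology or closed, as a subset of $\mathbb B(\mathscr H)$, in the weak operator topology. Then there exists a unitary operator $U\in\mathbb B(\mathscr H)$ such that $A^n\le U^*B^nU$ for every positive integer $n$. -/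

import Mathlib

/-- The set `𝒦_{n,A,B}` of all unitary operators `U` on `H` with `A ^ n ≤ U* B ^ n U`, as a set of
bounded operators. Here `≤` is the Loewner order and `star` is the Hilbert space adjoint. -/
def unitaryDominators {H : Type*} [NormedAddCommGroup H] [InnerProductSpace ℂ H] [CompleteSpace H]
    (n : ℕ) (A B : H →L[ℂ] H) : Set (H →L[ℂ] H) :=
  {U | U ∈ unitary (H →L[ℂ] H) ∧ A ^ n ≤ star U * B ^ n * U}

/-- A set of bounded operators is compact in the strong operator topology, the topology of
pointwise norm convergence. -/
def IsSOTCompact {H : Type*} [NormedAddCommGroup H] [InnerProductSpace ℂ H]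
    (K : Set (H →L[ℂ] H)) : Prop :=
  IsCompact (ContinuousLinearMap.toPointwiseConvergenceCLM ℂ (RingHom.id ℂ) H H '' K)

/-- A set of bounded operators is closed, as a subset of the space of all bounded operators, in the
weak operator topology. -/
def IsWOTClosed {H : Type*} [NormedAddCommGroup H] [InnerProductSpace ℂ H]
    (K : Set (H →L[ℂ] H)) : Prop :=
  IsClosed ((ContinuousLinearMapWOT.ofCLM : (H →L[ℂ] H) → H →WOT[ℂ] H) '' K)

/-!
If `p ≤ q` with `p` invertible, then `p² ≤ p^{1/2} q p^{1/2} = x x*` and `x* x = q^{1/2} p q^{1/2}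
≤ q²` for the invertible element `x = p^{1/2} q^{1/2}`, while `x x*` and `x* x` are unitarily
equivalent by polar decomposition; hence `p² ≤ w* q² w` for some unitary `w`. Iterating gives such
an inequality for the exponent `2 ^ k`, and the Löwner–Heinz inequality hands the same `w` down to
every exponent `m ≤ 2 ^ k`. Applied to `A ^ n₀ + ε` and `B ^ n₀ + ε`, the exponent `1` shows that
these unitaries stay in `𝒦_{n₀,A,B}`, so the hypothesis on that set provides a limit as `ε → 0` and
`k → ∞`. On unitaries weak convergence is strong convergence, which is what preserves the
inequalities in the limit; a last use of Löwner–Heinz descends from exponent `n₀ n` to `n`.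
-/

section Unitary

variable {R : Type*}

lemma star_mul_mul_pow_of_mem_unitary [Monoid R] [StarMul R] {w : R} (hw : w ∈ unitary R) (b : R)
    (n : ℕ) : (star w * b * w) ^ n = star w * b ^ n * w :=
  (Unitary.toUnits ⟨w, hw⟩).conj_pow' b n

lemma star_mul_add_algebraMap_mul_of_mem_unitary {𝕜 : Type*} [CommSemiring 𝕜] [Semiring R]
    [StarMul R] [Algebra 𝕜 R] {w : R} (hw : w ∈ unitary R) (b : R) (r : 𝕜) :
    star w * (b + algebraMap 𝕜 R r) * w = star w * b * w + algebraMap 𝕜 R r := by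
  rw [mul_add, add_mul, ← Algebra.commutes r (star w), mul_assoc (algebraMap 𝕜 R r),
    Unitary.star_mul_self_of_mem hw, mul_one]

lemma isBounded_unitary [NormedRing R] [StarRing R] [CStarRing R] :
    Bornology.IsBounded (unitary R : Set R) := by
  refine isBounded_iff_forall_norm_le.2 ⟨1, fun w hw => ?_⟩
  rcases subsingleton_or_nontrivial R with _ | _
  · simp [Subsingleton.elim w 0]
  · exact (CStarRing.norm_of_mem_unitary hw).le

end Unitary

section CStarAlgebra

variable {𝒜 : Type*} [CStarAlgebra 𝒜] [PartialOrder 𝒜] [StarOrderedRing 𝒜]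

lemma isUnit_abs_of_isUnit {x : 𝒜} (hx : IsUnit x) : IsUnit (CFC.abs x) := by
  rw [CFC.abs, CFC.isUnit_sqrt_iff _ (star_mul_self_nonneg x)]
  exact hx.star.mul hx

lemma exists_unitary_eq_mul_abs_of_isUnit {x : 𝒜} (hx : IsUnit x) :
    ∃ w ∈ unitary 𝒜, x = w * CFC.abs x := by
  obtain ⟨u, hu⟩ := isUnit_abs_of_isUnit hx
  have hstar : star (↑u⁻¹ : 𝒜) = ↑u⁻¹ := by
    have hu_star : star u = u := Units.ext <| by
      rw [Units.coe_star, hu, (CFC.abs_nonneg x).isSelfAdjoint.star_eq]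
    rw [← Units.coe_star_inv, hu_star]
  refine ⟨x * ↑u⁻¹, (hx.mul u⁻¹.isUnit).mem_unitary_of_star_mul_self ?_, by simp [← hu]⟩
  calc star (x * ↑u⁻¹) * (x * ↑u⁻¹) = ↑u⁻¹ * (star x * x) * ↑u⁻¹ := by
        rw [star_mul, hstar]; noncomm_ring
    _ = ↑u⁻¹ * (u * u) * ↑u⁻¹ := by rw [← CFC.abs_mul_abs x, hu]
    _ = 1 := by simp

lemma exists_unitary_mul_star_self_eq_of_isUnit {x : 𝒜} (hx : IsUnit x) :
    ∃ w ∈ unitary 𝒜, x * star x = w * (star x * x) * star w := by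
  obtain ⟨w, hw, hxw⟩ := exists_unitary_eq_mul_abs_of_isUnit hx
  refine ⟨w, hw, ?_⟩
  calc x * star x = w * CFC.abs x * star (w * CFC.abs x) := by rw [← hxw]
    _ = w * (CFC.abs x * CFC.abs x) * star w := by
      rw [star_mul, (CFC.abs_nonneg x).isSelfAdjoint.star_eq]; noncomm_ring
    _ = w * (star x * x) * star w := by rw [CFC.abs_mul_abs]

lemma exists_unitary_sq_le {p q : 𝒜} (hp : IsStrictlyPositive p) (hpq : p ≤ q) :
    ∃ w ∈ unitary 𝒜, p ^ 2 ≤ star w * q ^ 2 * w := by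
  have hq : IsStrictlyPositive q := hp.of_le hpq
  set r := CFC.sqrt p
  set s := CFC.sqrt q
  have hr : 0 ≤ r := CFC.sqrt_nonneg p
  have hs : 0 ≤ s := CFC.sqrt_nonneg q
  have hrr : r * r = p := CFC.sqrt_mul_sqrt_self p hp.nonneg
  have hss : s * s = q := CFC.sqrt_mul_sqrt_self q hq.nonneg
  have hstar : star (r * s) = s * r := by
    rw [star_mul, hr.isSelfAdjoint.star_eq, hs.isSelfAdjoint.star_eq]
  have h_left : p ^ 2 ≤ r * s * star (r * s) :=
    calc p ^ 2 = r * p * r := by rw [← hrr]; noncomm_ring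
      _ ≤ r * q * r := conjugate_le_conjugate_of_nonneg hpq hr
      _ = r * s * star (r * s) := by rw [hstar, ← hss]; noncomm_ring
  have h_right : star (r * s) * (r * s) ≤ q ^ 2 :=
    calc star (r * s) * (r * s) = s * p * s := by rw [hstar, ← hrr]; noncomm_ring
      _ ≤ s * q * s := conjugate_le_conjugate_of_nonneg hpq hs
      _ = q ^ 2 := by rw [← hss]; noncomm_ring
  obtain ⟨w, hw, h⟩ :=
    exists_unitary_mul_star_self_eq_of_isUnit (hp.isUnit_cfcSqrt.mul hq.isUnit_cfcSqrt)
  refine ⟨star w, Unitary.star_mem hw, ?_⟩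
  rw [star_star]
  exact h_left.trans (h.le.trans (star_right_conjugate_le_conjugate h_right w))

lemma exists_unitary_pow_two_pow_le {p q v : 𝒜} (hp : IsStrictlyPositive p) (hv : v ∈ unitary 𝒜)
    (hpq : p ≤ star v * q * v) (k : ℕ) :
    ∃ w ∈ unitary 𝒜, p ^ 2 ^ k ≤ star w * q ^ 2 ^ k * w := by
  induction k with
  | zero => exact ⟨v, hv, by simpa using hpq⟩
  | succ k ih =>
    obtain ⟨w, hw, h⟩ := ih
    have hpk : IsStrictlyPositive (p ^ 2 ^ k) :=
      ⟨CStarAlgebra.pow_nonneg hp.nonneg _, hp.isUnit.pow _⟩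
    obtain ⟨u, hu, h_sq⟩ := exists_unitary_sq_le hpk h
    refine ⟨w * u, mul_mem hw hu, ?_⟩
    rw [star_mul_mul_pow_of_mem_unitary hw, ← pow_mul, ← pow_mul, ← pow_succ] at h_sq
    simpa only [star_mul, mul_assoc] using h_sq

lemma pow_le_pow_of_pow_le_pow_of_le {a b : 𝒜} (ha : 0 ≤ a) (hb : 0 ≤ b) {m n : ℕ} (hmn : m ≤ n)
    (h : a ^ n ≤ b ^ n) : a ^ m ≤ b ^ m := by
  rcases n.eq_zero_or_pos with rfl | hn
  · obtain rfl := Nat.le_zero.1 hmn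
    exact h
  have hn' : (0 : ℝ) < n := Nat.cast_pos.2 hn
  have rpow_div (c : 𝒜) (hc : 0 ≤ c) : (c ^ n) ^ ((m : ℝ) / n) = c ^ m := by
    rw [← CFC.rpow_natCast c n, CFC.rpow_rpow_of_exponent_nonneg c _ _ hn'.le (by positivity),
      mul_div_cancel₀ _ hn'.ne', CFC.rpow_natCast c m]
  rw [← rpow_div a ha, ← rpow_div b hb]
  exact CFC.rpow_le_rpow ⟨by positivity, div_le_one_of_le₀ (Nat.cast_le.2 hmn) hn'.le⟩ h

lemma pow_le_star_mul_pow_mul_of_le {a b w : 𝒜} (ha : 0 ≤ a) (hb : 0 ≤ b) (hw : w ∈ unitary 𝒜)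
    {m n : ℕ} (hmn : m ≤ n) (h : a ^ n ≤ star w * b ^ n * w) : a ^ m ≤ star w * b ^ m * w := by
  rw [← star_mul_mul_pow_of_mem_unitary hw] at h ⊢
  exact pow_le_pow_of_pow_le_pow_of_le ha (star_left_conjugate_nonneg hb w) hmn h

lemma exists_unitary_forall_pow_le {p q v : 𝒜} (hp : IsStrictlyPositive p) (hq : 0 ≤ q)
    (hv : v ∈ unitary 𝒜) (hpq : p ≤ star v * q * v) (N : ℕ) :
    ∃ w ∈ unitary 𝒜, ∀ m ≤ N, p ^ m ≤ star w * q ^ m * w := by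
  obtain ⟨w, hw, h⟩ := exists_unitary_pow_two_pow_le hp hv hpq N
  exact ⟨w, hw, fun m hm =>
    pow_le_star_mul_pow_mul_of_le hp.nonneg hq hw (hm.trans N.lt_two_pow_self.le) h⟩

lemma exists_unitary_le_and_forall_add_algebraMap_pow_le {a b v : 𝒜} (ha : 0 ≤ a) (hb : 0 ≤ b)
    (hv : v ∈ unitary 𝒜) (hab : a ≤ star v * b * v) {ε : ℝ} (hε : 0 < ε) (N : ℕ) :
    ∃ w ∈ unitary 𝒜, a ≤ star w * b * w ∧
      ∀ m ≤ N, (a + algebraMap ℝ 𝒜 ε) ^ m ≤ star w * (b + algebraMap ℝ 𝒜 ε) ^ m * w := by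
  have hε' : IsStrictlyPositive (algebraMap ℝ 𝒜 ε) := isStrictlyPositive_algebraMap hε
  have add_le_iff {w : 𝒜} (hw : w ∈ unitary 𝒜) :
      a + algebraMap ℝ 𝒜 ε ≤ star w * (b + algebraMap ℝ 𝒜 ε) * w ↔ a ≤ star w * b * w := by
    rw [star_mul_add_algebraMap_mul_of_mem_unitary hw, add_le_add_iff_right]
  obtain ⟨w, hw, h⟩ := exists_unitary_forall_pow_le (hε'.nonneg_add ha)
    (hε'.nonneg_add hb).nonneg hv ((add_le_iff hv).2 hab) (N + 1)
  have h_one := h 1 (Nat.le_add_left 1 N)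
  rw [pow_one, pow_one, add_le_iff hw] at h_one
  exact ⟨w, hw, h_one, fun m hm => h m (hm.trans N.le_succ)⟩

end CStarAlgebra

open Filter Topology
open scoped InnerProductSpace

section WeakOperatorTopology

variable {𝕜 E H ι : Type*} [RCLike 𝕜] [NormedAddCommGroup E] [NormedSpace 𝕜 E]
  [NormedAddCommGroup H] [InnerProductSpace 𝕜 H]

lemma tendsto_of_tendsto_inner_of_tendsto_norm {F : Filter ι} {u : ι → H} {z : H}
    (h_inner : Tendsto (fun i => ⟪z, u i⟫_𝕜) F (𝓝 ⟪z, z⟫_𝕜))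
    (h_norm : Tendsto (fun i => ‖u i‖) F (𝓝 ‖z‖)) : Tendsto u F (𝓝 z) := by
  have h_re : Tendsto (fun i => RCLike.re ⟪z, u i⟫_𝕜) F (𝓝 (‖z‖ ^ 2)) := by
    rw [← inner_self_eq_norm_sq (𝕜 := 𝕜) z]
    exact (RCLike.continuous_re.tendsto _).comp h_inner
  have h_sq : Tendsto (fun i => ‖z - u i‖ ^ 2) F (𝓝 0) := by
    simp only [norm_sub_sq (𝕜 := 𝕜)]
    convert ((h_re.const_mul 2).const_sub (‖z‖ ^ 2)).add (h_norm.pow 2) using 2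
    ring
  rw [tendsto_iff_norm_sub_tendsto_zero]
  simpa [norm_sub_rev] using h_sq.sqrt

variable [CompleteSpace H]

lemma exists_forall_tendsto_inner_of_norm_le (F : Ultrafilter ι) {u : ι → H} {r : ℝ}
    (hu : ∀ᶠ i in F, ‖u i‖ ≤ r) :
    ∃ z : H, ‖z‖ ≤ r ∧ ∀ y, Tendsto (fun i => ⟪y, u i⟫_𝕜) F (𝓝 ⟪y, z⟫_𝕜) := by
  let φ : ι → WeakDual 𝕜 H := fun i =>
    StrongDual.toWeakDual (InnerProductSpace.toDual 𝕜 H (u i))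
  obtain ⟨ψ, hψ, hlim⟩ := (WeakDual.isCompact_closedBall (𝕜 := 𝕜) (E := H) 0 r).ultrafilter_le_nhds'
    (F.map φ) (mem_map.2 (hu.mono fun i hi => by simpa [φ] using hi))
  refine ⟨(InnerProductSpace.toDual 𝕜 H).symm (WeakDual.toStrongDual ψ), by simpa using hψ,
    fun y => ?_⟩
  have h_eval : Tendsto (fun i => ⟪u i, y⟫_𝕜) F
      (𝓝 ⟪(InnerProductSpace.toDual 𝕜 H).symm (WeakDual.toStrongDual ψ), y⟫_𝕜) := by
    rw [InnerProductSpace.toDual_symm_apply]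
    exact ((WeakDual.eval_continuous y).tendsto ψ).comp hlim
  simpa only [RCLike.star_def, inner_conj_symm] using h_eval.star

lemma isCompact_image_ofCLM_closedBall (c : ℝ) :
    IsCompact (ContinuousLinearMapWOT.ofCLM '' Metric.closedBall (0 : E →L[𝕜] H) c) := by
  refine isCompact_iff_ultrafilter_le_nhds'.2 fun F hF => ?_
  have h_norm : ∀ᶠ T : E →WOT[𝕜] H in F, ‖T.toCLM‖ ≤ c := by
    filter_upwards [hF]
    rintro _ ⟨T, hT, rfl⟩
    simpa using hT
  have hc : 0 ≤ c := by
    obtain ⟨T, hT⟩ := h_norm.exists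
    exact (norm_nonneg _).trans hT
  choose S hS_norm hS_lim using fun x : E =>
    exists_forall_tendsto_inner_of_norm_le (𝕜 := 𝕜) F (u := fun T : E →WOT[𝕜] H => T x)
      (h_norm.mono fun T hT => T.toCLM.le_of_opNorm_le hT x)
  let L : E →ₗ[𝕜] H :=
    { toFun := S
      map_add' := fun x x' => ext_inner_left 𝕜 fun y =>
        tendsto_nhds_unique (hS_lim (x + x') y)
          (by simpa [inner_add_right] using (hS_lim x y).add (hS_lim x' y))
      map_smul' := fun a x => ext_inner_left 𝕜 fun y =>
        tendsto_nhds_unique (hS_lim (a • x) y)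
          (by simpa [inner_smul_right] using (hS_lim x y).const_mul a) }
  refine ⟨.ofCLM (L.mkContinuous c hS_norm), ⟨_, ?_, rfl⟩,
    ContinuousLinearMapWOT.le_nhds_iff_forall_inner_apply_le_nhds.2 hS_lim⟩
  simpa using L.mkContinuous_norm_le hc hS_norm

lemma tendsto_apply_of_tendsto_ofCLM_of_mem_unitary {F : Filter ι} {V : ι → H →L[𝕜] H}
    {U : H →L[𝕜] H} (hV : ∀ i, V i ∈ unitary (H →L[𝕜] H)) (hU : U ∈ unitary (H →L[𝕜] H))
    (h : Tendsto (fun i => ContinuousLinearMapWOT.ofCLM (V i)) F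
      (𝓝 (ContinuousLinearMapWOT.ofCLM U))) (x : H) : Tendsto (fun i => V i x) F (𝓝 (U x)) := by
  refine tendsto_of_tendsto_inner_of_tendsto_norm (𝕜 := 𝕜)
    (ContinuousLinearMapWOT.tendsto_iff_forall_inner_apply_tendsto.1 h x (U x)) ?_
  simp only [ContinuousLinearMap.norm_map_of_mem_unitary, hV, hU]
  exact tendsto_const_nhds

end WeakOperatorTopology

section Complex

variable {H ι : Type*} [NormedAddCommGroup H] [InnerProductSpace ℂ H]

lemma isCompact_image_ofCLM_of_isSOTCompact {K : Set (H →L[ℂ] H)} (hK : IsSOTCompact K) :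
    IsCompact (ContinuousLinearMapWOT.ofCLM '' K) := by
  have h_cont : Continuous fun T : H →Lₚₜ[ℂ] H =>
      (ContinuousLinearMapWOT.ofCLM (show H →L[ℂ] H from T) : H →WOT[ℂ] H) :=
    ContinuousLinearMapWOT.continuous_of_dual_apply_continuous fun x y =>
      y.continuous.comp (continuous_eval_const x)
  simpa only [Set.image_image] using! hK.image h_cont

lemma le_of_tendsto_inner_apply_self {F : Filter ι} [F.NeBot] {S T : ι → H →L[ℂ] H}
    {S₀ T₀ : H →L[ℂ] H} (hS : ∀ x, Tendsto (fun i => ⟪S i x, x⟫_ℂ) F (𝓝 ⟪S₀ x, x⟫_ℂ))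
    (hT : ∀ x, Tendsto (fun i => ⟪T i x, x⟫_ℂ) F (𝓝 ⟪T₀ x, x⟫_ℂ)) (h : ∀ᶠ i in F, S i ≤ T i) :
    S₀ ≤ T₀ := by
  open scoped ComplexOrder in
  have h_nonneg (x : H) : 0 ≤ ⟪(T₀ - S₀) x, x⟫_ℂ := by
    simp only [sub_apply, inner_sub_left]
    refine ge_of_tendsto ((hT x).sub (hS x)) (h.mono fun i hi => ?_)
    simpa only [sub_apply, inner_sub_left] using
      ((ContinuousLinearMap.le_def _ _).1 hi).inner_nonneg_left x
  rw [ContinuousLinearMap.le_def, ContinuousLinearMap.isPositive_iff_complex]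
  exact fun x => ⟨(Complex.eq_re_of_ofReal_le (h_nonneg x)).symm, (Complex.le_def.1 (h_nonneg x)).1⟩

variable [CompleteSpace H]

lemma isCompact_image_ofCLM_of_isWOTClosed {K : Set (H →L[ℂ] H)} (hKb : Bornology.IsBounded K)
    (hK : IsWOTClosed K) : IsCompact (ContinuousLinearMapWOT.ofCLM '' K) := by
  obtain ⟨c, hc⟩ := hKb.subset_closedBall 0
  exact (isCompact_image_ofCLM_closedBall c).of_isClosed_subset hK (Set.image_mono hc)

lemma le_star_mul_mul_of_tendsto {F : Filter ι} [F.NeBot] {S T V : ι → H →L[ℂ] H}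
    {S₀ T₀ U : H →L[ℂ] H} (hS : Tendsto S F (𝓝 S₀)) (hT : Tendsto T F (𝓝 T₀))
    (hV : ∀ x, Tendsto (fun i => V i x) F (𝓝 (U x)))
    (h : ∀ᶠ i in F, S i ≤ star (V i) * T i * V i) : S₀ ≤ star U * T₀ * U := by
  have inner_star_mul_mul (P W : H →L[ℂ] H) (x : H) :
      ⟪(star W * P * W) x, x⟫_ℂ = ⟪P (W x), W x⟫_ℂ := by
    simp [ContinuousLinearMap.star_eq_adjoint, ContinuousLinearMap.adjoint_inner_left]
  have tendsto_apply {R : ι → H →L[ℂ] H} {R₀ : H →L[ℂ] H} {v : ι → H} {v₀ : H}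
      (hR : Tendsto R F (𝓝 R₀)) (hv : Tendsto v F (𝓝 v₀)) :
      Tendsto (fun i => R i (v i)) F (𝓝 (R₀ v₀)) :=
    (isBoundedBilinearMap_apply.continuous.tendsto (R₀, v₀)).comp (hR.prodMk_nhds hv)
  refine le_of_tendsto_inner_apply_self (fun x => ?_) (fun x => ?_) h
  · exact (tendsto_apply hS tendsto_const_nhds).inner tendsto_const_nhds
  · simp only [inner_star_mul_mul]
    exact (tendsto_apply hT (hV x)).inner (hV x)

lemma exists_mem_forall_pow_le_of_isCompact {K : Set (H →L[ℂ] H)}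
    (hKu : K ⊆ unitary (H →L[ℂ] H)) (hK : IsCompact (ContinuousLinearMapWOT.ofCLM '' K))
    {A B : H →L[ℂ] H}
    (h : ∀ ε : ℝ, 0 < ε → ∀ N : ℕ, ∃ W ∈ K, ∀ m ≤ N,
      (A + algebraMap ℝ (H →L[ℂ] H) ε) ^ m ≤ star W * (B + algebraMap ℝ (H →L[ℂ] H) ε) ^ m * W) :
    ∃ U ∈ K, ∀ m : ℕ, A ^ m ≤ star U * B ^ m * U := by
  choose W hWK hW using fun j : ℕ => h (1 / ((j : ℝ) + 1)) Nat.one_div_pos_of_nat j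
  let F : Ultrafilter ℕ := Ultrafilter.of atTop
  have hF : (F : Filter ℕ) ≤ atTop := Ultrafilter.of_le atTop
  obtain ⟨_, ⟨U, hU, rfl⟩, hlim⟩ := hK.ultrafilter_le_nhds'
    (F.map fun j => ContinuousLinearMapWOT.ofCLM (W j))
    (mem_map.2 (univ_mem' fun j => Set.mem_image_of_mem _ (hWK j)))
  have h_pow (T : H →L[ℂ] H) (m : ℕ) :
      Tendsto (fun j : ℕ => (T + algebraMap ℝ (H →L[ℂ] H) (1 / ((j : ℝ) + 1))) ^ m) F
        (𝓝 (T ^ m)) := by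
    have h_zero := ((continuous_algebraMap ℝ (H →L[ℂ] H)).tendsto 0).comp
      (tendsto_one_div_add_atTop_nhds_zero_nat (𝕜 := ℝ))
    simpa using ((h_zero.const_add T).pow m).mono_left hF
  refine ⟨U, hU, fun m => le_star_mul_mul_of_tendsto (h_pow A m) (h_pow B m)
    (tendsto_apply_of_tendsto_ofCLM_of_mem_unitary (fun j => hKu (hWK j)) (hKu hU) hlim) (hF ?_)⟩
  filter_upwards [eventually_ge_atTop m] with j hj using hW j m hj

end Complex

theorem theorem2p9 {H : Type*} [NormedAddCommGroup H] [InnerProductSpace ℂ H] [CompleteSpace H]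
    (A B : H →L[ℂ] H) (hA : A.IsPositive) (hB : B.IsPositive)
    (n₀ : ℕ) (hn₀ : 1 ≤ n₀)
    (hne : (unitaryDominators n₀ A B).Nonempty)
    (hK : IsSOTCompact (unitaryDominators n₀ A B) ∨ IsWOTClosed (unitaryDominators n₀ A B)) :
    ∃ U ∈ unitary (H →L[ℂ] H), ∀ n : ℕ, 1 ≤ n → A ^ n ≤ star U * B ^ n * U := by
  have hA₀ : 0 ≤ A := A.nonneg_iff_isPositive.2 hA
  have hB₀ : 0 ≤ B := B.nonneg_iff_isPositive.2 hB
  have hKu : unitaryDominators n₀ A B ⊆ unitary (H →L[ℂ] H) := fun _ hU => hU.1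
  have hKc : IsCompact (ContinuousLinearMapWOT.ofCLM '' unitaryDominators n₀ A B) :=
    hK.elim isCompact_image_ofCLM_of_isSOTCompact
      (isCompact_image_ofCLM_of_isWOTClosed (isBounded_unitary.subset hKu))
  obtain ⟨V, hV, hAB⟩ := hne
  obtain ⟨U, ⟨hU, -⟩, h⟩ := exists_mem_forall_pow_le_of_isCompact hKu hKc fun ε hε N =>
    have ⟨W, hW, hAW, hpow⟩ := exists_unitary_le_and_forall_add_algebraMap_pow_le
      (CStarAlgebra.pow_nonneg hA₀ n₀) (CStarAlgebra.pow_nonneg hB₀ n₀) hV hAB hε N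
    ⟨W, ⟨hW, hAW⟩, hpow⟩
  refine ⟨U, hU, fun n _ => ?_⟩
  have h_mul : A ^ (n₀ * n) ≤ star U * B ^ (n₀ * n) * U := by simpa only [pow_mul] using h n
  exact pow_le_star_mul_pow_mul_of_le hA₀ hB₀ hU (Nat.le_mul_of_pos_left n hn₀) h_mul
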